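/- Let $X$ be a real separable Banach space and let $A : D(A)\subseteq X\to X$ be a closed, densely defined linear operator which is strictly $m$-dissipative, i.e. for every $t>0$ one has $\|(I-tA)u\|>\|u\|$ for all $0\ne u\in D(A)$, and $I-tA$ maps $D(A)$ onto $X$. Put $$[u,v]:=\|v\|\lim_{\varepsilon\to0^-}\frac{\|v+\varepsilon u\|-\|v\|}{\varepsilon},\qquad \mu(A):=\sup_{0\ne u\in D(A)}\frac{[Au,u]}{\|u\|^2},$$ and assume that $\mu(A)<0$. Let $(T(t))_{t\ge0}$ be the strongly continuous semigroup generated by $A$. For $0<s<1$ let $(-A)^s$ be the fractional power of $-A$ defined through the Balakrishnan operator $$J_B^su=\frac{1}{\Gamma(s)\Gamma(1-s)}\int_0^\infty z^{s-1}(z+B)^{-1}Bu\,dz,\qquad u\in D(B),$$ that is, $(-A)^s=J_{-A}^s$ if $A$ is bounded, and $(-A)^s=\bigl(J^s_{(-A)^{-1}}\bigr)^{-1}$ if $A$ is unbounded (as $\mu(A)<0$, the operator $-A$ has a bounded inverse on $X$). For $u_0\in D((-A)^s)$, $t\ge0$ and $M>0$ define $$u(t)=\frac1{\Gamma(s)}\int_0^\infty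 z^{s-1}e^{-t^2/(4z)}T(z)(-A)^su_0\,dz,\qquad u^{(M)}(t)=\frac1{\Gamma(s)}\int_0^M z^{s-1}e^{-t^2/(4z)}T(z)(-A)^su_0\,dz .$$ Then these integrals converge absolutely, and there is a constant $C>0$, depending only on $\mu(A)$ (in particular not on $s$, $t$, $M$ or $u_0$), such that $$\|u(t)-u^{(M)}(t)\|\le C\,M^{s-1}e^{\mu(A)M}\,\|(-A)^su_0\|\qquad\text{for all } t\ge0,\ M>0,\ 0<s<1,\ u_0\in D((-A)^s).$$ -/

import Mathlib

open Filter Topology Set MeasureTheory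

namespace BesselExtension

noncomputable section

/-! Unbounded operators on a real Banach space are partially defined linear maps
`A : X →ₗ.[ℝ] X` with domain `A.domain`. -/

/-- `A` is strictly dissipative: `‖(I - tA)u‖ > ‖u‖` for all `t > 0` and all `u ≠ 0` in `D(A)`. -/
def StrictlyDissipative {X : Type*} [NormedAddCommGroup X] [NormedSpace ℝ X]
    (A : X →ₗ.[ℝ] X) : Prop :=
  ∀ u : A.domain, (u : X) ≠ 0 → ∀ t : ℝ, 0 < t → ‖(u : X)‖ < ‖(u : X) - t • A u‖

/-- `A` is strictly m-dissipative: strictly dissipative, and `I - tA` maps `D(A)` onto `X` for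
all `t > 0`. -/
def StrictlyMDissipative {X : Type*} [NormedAddCommGroup X] [NormedSpace ℝ X]
    (A : X →ₗ.[ℝ] X) : Prop :=
  StrictlyDissipative A ∧
    ∀ t : ℝ, 0 < t → ∀ y : X, ∃ u : A.domain, (u : X) - t • A u = y

/-- The left semi-inner-product
`[u, v] = ‖v‖ * lim_{ε → 0⁻} (‖v + ε u‖ - ‖v‖) / ε`; the limit always exists, because the
difference quotient of the convex function `ε ↦ ‖v + ε u‖` is monotone and bounded. -/
def semiInner {X : Type*} [NormedAddCommGroup X] [NormedSpace ℝ X] (u v : X) : ℝ :=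
  ‖v‖ * limUnder (𝓝[<] (0 : ℝ)) (fun ε : ℝ => (‖v + ε • u‖ - ‖v‖) / ε)

/-- The logarithmic norm `μ(A) = sup { [Au, u] / ‖u‖² : u ∈ D(A), u ≠ 0 }`. (The real supremum
of an empty or unbounded set is `0`, so `μ(A) < 0` says that the set is nonempty and bounded
above, and that its least upper bound is negative.) -/
def logNorm {X : Type*} [NormedAddCommGroup X] [NormedSpace ℝ X] (A : X →ₗ.[ℝ] X) : ℝ :=
  sSup {r : ℝ | ∃ u : A.domain, (u : X) ≠ 0 ∧ r = semiInner (A u) (u : X) / ‖(u : X)‖ ^ 2}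

/-- `(T(t))_{t ≥ 0}` is a strongly continuous semigroup of bounded operators. Only the values
of `T` at `t ≥ 0` matter. -/
structure IsC0Semigroup {X : Type*} [NormedAddCommGroup X] [NormedSpace ℝ X]
    (T : ℝ → X →L[ℝ] X) : Prop where
  map_zero : T 0 = ContinuousLinearMap.id ℝ X
  map_add : ∀ a b : ℝ, 0 ≤ a → 0 ≤ b → T (a + b) = (T a).comp (T b)
  tendsto_zero : ∀ x : X, Tendsto (fun t : ℝ => T t x) (𝓝[>] 0) (𝓝 x)

/-- `A` is the infinitesimal generator of `T`: `x ∈ D(A)` and `A x = y` if and only if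
`(T(h)x - x)/h → y` as `h → 0⁺`. -/
def IsGenerator {X : Type*} [NormedAddCommGroup X] [NormedSpace ℝ X]
    (A : X →ₗ.[ℝ] X) (T : ℝ → X →L[ℝ] X) : Prop :=
  ∀ x y : X, (x, y) ∈ A.graph ↔
    Tendsto (fun h : ℝ => h⁻¹ • (T h x - x)) (𝓝[>] 0) (𝓝 y)

/-- The map `z + B : D(B) → X`. -/
def shiftedMap {X : Type*} [NormedAddCommGroup X] [NormedSpace ℝ X]
    (B : X →ₗ.[ℝ] X) (z : ℝ) : B.domain →ₗ[ℝ] X :=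
  z • B.domain.subtype + B.toFun

open Classical in
/-- The inverse `(z + B)⁻¹ : X → X` where `z + B : D(B) → X` is bijective (and `0` otherwise). -/
def shiftedInv {X : Type*} [NormedAddCommGroup X] [NormedSpace ℝ X]
    (B : X →ₗ.[ℝ] X) (z : ℝ) : X →ₗ[ℝ] X :=
  if h : Function.Bijective (shiftedMap B z) then
    B.domain.subtype ∘ₗ (LinearEquiv.ofBijective (shiftedMap B z) h).symm.toLinearMap
  else 0

/-- The integrand `z^(s-1) (z + B)⁻¹ B u` of the Balakrishnan operator. -/
def balakrishnanIntegrand {X : Type*} [NormedAddCommGroup X] [NormedSpace ℝ X]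
    (B : X →ₗ.[ℝ] X) (s : ℝ) (u : B.domain) (z : ℝ) : X :=
  z ^ (s - 1) • shiftedInv B z (B u)

/-- The elements of `D(B)` for which the Balakrishnan integral converges absolutely. -/
def balakrishnanDomain {X : Type*} [NormedAddCommGroup X] [NormedSpace ℝ X]
    (B : X →ₗ.[ℝ] X) (s : ℝ) : Submodule ℝ B.domain where
  carrier := {u | IntegrableOn (balakrishnanIntegrand B s u) (Ioi (0 : ℝ))}
  zero_mem' := by
    have h : balakrishnanIntegrand B s 0 = fun _ => (0 : X) := by
      funext z; simp [balakrishnanIntegrand]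
    simp only [mem_ofPred_eq, h]
    exact integrableOn_zero
  add_mem' := by
    intro u v hu hv
    have h : balakrishnanIntegrand B s (u + v)
        = balakrishnanIntegrand B s u + balakrishnanIntegrand B s v := by
      funext z; simp [balakrishnanIntegrand, LinearPMap.map_add]
    simp only [mem_ofPred_eq, h] at *
    exact hu.add hv
  smul_mem' := by
    intro c u hu
    have h : balakrishnanIntegrand B s (c • u) = c • balakrishnanIntegrand B s u := by
      funext z; simp [balakrishnanIntegrand, LinearPMap.map_smul, smul_comm c]
    simp only [mem_ofPred_eq, h] at *
    exact hu.smul c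

/-- The Balakrishnan operator with base `B` and power `s`,
`J_B^s u = (1 / (Γ(s) Γ(1 - s))) ∫_0^∞ z^(s-1) (z + B)⁻¹ B u dz`,
on the elements `u` of `D(B)` for which the integral converges absolutely (these are all
elements of `D(B)` when `‖z (z + B)⁻¹‖` is bounded over `z > 0` and `0 < s < 1`). -/
def balakrishnan {X : Type*} [NormedAddCommGroup X] [NormedSpace ℝ X]
    (B : X →ₗ.[ℝ] X) (s : ℝ) : X →ₗ.[ℝ] X where
  domain := (balakrishnanDomain B s).map B.domain.subtype
  toFun :=
    ({ toFun := fun u => (1 / (Real.Gamma s * Real.Gamma (1 - s))) •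
          ∫ z in Ioi (0 : ℝ), balakrishnanIntegrand B s u.1 z
       map_add' := by
        intro u v
        rw [← smul_add, ← integral_add u.2 v.2]
        congr 2
        funext z; simp [balakrishnanIntegrand, LinearPMap.map_add]
       map_smul' := by
        intro c u
        rw [RingHom.id_apply, smul_comm c, ← integral_smul c]
        congr 2
        funext z; simp [balakrishnanIntegrand, LinearPMap.map_smul, smul_comm c] } :
      balakrishnanDomain B s →ₗ[ℝ] X) ∘ₗ
    ((balakrishnanDomain B s).equivMapOfInjective B.domain.subtype
      B.domain.injective_subtype).symm.toLinearMap

/-- `B` is a bounded operator defined on all of `X`. -/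
def IsBoundedOperator {X : Type*} [NormedAddCommGroup X] [NormedSpace ℝ X]
    (B : X →ₗ.[ℝ] X) : Prop :=
  B.domain = ⊤ ∧ Continuous B.toFun

/-- `0` is in the resolvent set of `B`. -/
def ZeroInResolventSet {X : Type*} [NormedAddCommGroup X] [NormedSpace ℝ X]
    (B : X →ₗ.[ℝ] X) : Prop :=
  Function.Bijective B.toFun ∧ Continuous (shiftedInv B 0)

/-- The graph of `u ↦ lim_{δ → 0⁺} (B + δ)^s u`, where `(B + δ)^s` is the inverse of
`J^s` with base `(B + δ)⁻¹`: the pairs `(u, w)` with `u` in the closure of `D(B)`, such that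
`u ∈ D((B + δ)^s)` for all small `δ > 0` and `(B + δ)^s u → w` as `δ → 0⁺`. -/
def limitPowGraph {X : Type*} [NormedAddCommGroup X] [NormedSpace ℝ X]
    (B : X →ₗ.[ℝ] X) (s : ℝ) : Submodule ℝ (X × X) where
  carrier := {p | p.1 ∈ B.domain.topologicalClosure ∧ ∃ f : ℝ → X,
    (∀ᶠ δ in 𝓝[>] (0 : ℝ), (p.1, f δ) ∈
      (balakrishnan ((δ • (LinearMap.id : X →ₗ[ℝ] X)) +ᵥ B).inverse s).inverse.graph) ∧
    Tendsto f (𝓝[>] 0) (𝓝 p.2)}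
  zero_mem' := ⟨Submodule.zero_mem _, fun _ => 0,
    Eventually.of_forall fun _ => Submodule.zero_mem _, tendsto_const_nhds⟩
  add_mem' := by
    rintro p q ⟨hp, f, hf, hfl⟩ ⟨hq, g, hg, hgl⟩
    exact ⟨Submodule.add_mem _ hp hq, fun δ => f δ + g δ,
      by filter_upwards [hf, hg] with δ h1 h2 using Submodule.add_mem _ h1 h2, hfl.add hgl⟩
  smul_mem' := by
    rintro c p ⟨hp, f, hf, hfl⟩
    exact ⟨Submodule.smul_mem _ c hp, fun δ => c • f δ,
      by filter_upwards [hf] with δ h1 using Submodule.smul_mem _ c h1, hfl.const_smul c⟩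

open Classical in
/-- The fractional power `B^s`, `0 < s < 1`:
* `J_B^s` if `B` is bounded;
* the inverse of `J^s` with base `B⁻¹` if `B` is unbounded and `0` is in its resolvent set;
* `u ↦ lim_{δ → 0⁺} (B + δ)^s u`, with its natural domain, if `B` is unbounded and `0` is in
  its spectrum. -/
def fracPow {X : Type*} [NormedAddCommGroup X] [NormedSpace ℝ X]
    (B : X →ₗ.[ℝ] X) (s : ℝ) : X →ₗ.[ℝ] X :=
  if IsBoundedOperator B then balakrishnan B s
  else if ZeroInResolventSet B then (balakrishnan B.inverse s).inverse
  else (limitPowGraph B s).toLinearPMap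

/-- The integrand `z^(s-1) e^{-t²/(4z)} T(z) w`. -/
def solIntegrand {X : Type*} [NormedAddCommGroup X] [NormedSpace ℝ X]
    (T : ℝ → X →L[ℝ] X) (s : ℝ) (w : X) (t z : ℝ) : X :=
  (z ^ (s - 1) * Real.exp (-t ^ 2 / (4 * z))) • T z w

/-- `u(t) = (1/Γ(s)) ∫_0^∞ z^(s-1) e^{-t²/(4z)} T(z) w dz`, used with `w = (-A)^s u₀`. -/
def sol {X : Type*} [NormedAddCommGroup X] [NormedSpace ℝ X]
    (T : ℝ → X →L[ℝ] X) (s : ℝ) (w : X) (t : ℝ) : X :=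
  (1 / Real.Gamma s) • ∫ z in Ioi (0 : ℝ), solIntegrand T s w t z

/-- `u^{(M)}(t) = (1/Γ(s)) ∫_0^M z^(s-1) e^{-t²/(4z)} T(z) w dz`. -/
def truncSol {X : Type*} [NormedAddCommGroup X] [NormedSpace ℝ X]
    (T : ℝ → X →L[ℝ] X) (s M : ℝ) (w : X) (t : ℝ) : X :=
  (1 / Real.Gamma s) • ∫ z in (0 : ℝ)..M, solIntegrand T s w t z

end

end BesselExtension

namespace BesselExtension

/-! ### Left derivative of the norm and quantitative dissipativity -/

section DirectionalDerivative

variable {X : Type*} [NormedAddCommGroup X] [NormedSpace ℝ X]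

/-! Write `ω = logNorm A < 0`. Everything rests on the decay `‖T z x‖ ≤ e^{ωz}‖x‖`: given it, the
tail over `z > M` is controlled by `z^(s-1) ≤ M^(s-1)` and `∫_M^∞ e^{ωz} dz = e^{ωM}/(-ω)`, while
`Γ(s) ≥ 1` on `(0, 1]` removes the dependence on `s`. So `C = 1/(-ω)`.

For the decay, convexity of the norm turns the semi-inner-product bound into `(1 - ωh)‖u‖ ≤ ‖u -
hAu‖` (`one_sub_logNorm_mul_norm_le`). For `x ∈ D(A)` the orbit satisfies the implicit Euler scheme
up to an error `o(h)` per step (`norm_semigroup_step_le`). Taking `n` steps of length `a/n` gives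
`(1 - ωa/n)^(-n) → e^{ωa}` with vanishing total error, and density of `D(A)` gives all `x`. -/

theorem monotoneOn_norm_slope (u v : X) :
    MonotoneOn (fun ε : ℝ => (‖v + ε • u‖ - ‖v‖) / ε) (Iio 0) := by
  intro a ha b hb hab
  simp only [mem_Iio] at ha hb
  have hr0 : 0 ≤ b / a := (div_pos_of_neg_of_neg hb ha).le
  have hr1 : b / a ≤ 1 := by rw [div_le_one_of_neg ha]; exact hab
  have hdecomp : v + b • u = (1 - b / a) • v + (b / a) • (v + a • u) := by
    rw [smul_add, smul_smul, div_mul_cancel₀ _ ha.ne, sub_smul, one_smul]; abel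
  have hconv : ‖v + b • u‖ ≤ (1 - b / a) * ‖v‖ + b / a * ‖v + a • u‖ := by
    rw [hdecomp]
    refine (norm_add_le _ _).trans_eq ?_
    rw [norm_smul_of_nonneg (by linarith), norm_smul_of_nonneg hr0]
  have key : ‖v + b • u‖ - ‖v‖ ≤ (‖v + a • u‖ - ‖v‖) / a * b := by
    calc ‖v + b • u‖ - ‖v‖ ≤ b / a * (‖v + a • u‖ - ‖v‖) := by linarith
      _ = _ := by ring
  exact (le_div_iff_of_neg hb).2 key

theorem norm_slope_le (u v : X) {ε : ℝ} (hε : ε < 0) : (‖v + ε • u‖ - ‖v‖) / ε ≤ ‖u‖ := by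
  rw [div_le_iff_of_neg hε]
  have h : ‖v‖ ≤ ‖v + ε • u‖ + ‖ε • u‖ := by
    simpa using norm_sub_le (v + ε • u) (ε • u)
  rw [norm_smul, Real.norm_of_nonpos hε.le] at h
  linarith

/-- The slopes increase as `ε → 0⁻` and are bounded, so their limit is their supremum. This passes
from the infinitesimal quantity to a finite step. -/
theorem norm_mul_norm_slope_le_semiInner (u v : X) {ε : ℝ} (hε : ε < 0) :
    ‖v‖ * ((‖v + ε • u‖ - ‖v‖) / ε) ≤ semiInner u v := by
  have hbdd : BddAbove ((fun ε : ℝ => (‖v + ε • u‖ - ‖v‖) / ε) '' Iio 0) :=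
    ⟨‖u‖, by rintro _ ⟨a, ha, rfl⟩; exact norm_slope_le u v ha⟩
  have hlim := (monotoneOn_norm_slope u v).tendsto_nhdsLT hbdd
  rw [semiInner, hlim.limUnder_eq]
  exact mul_le_mul_of_nonneg_left (le_csSup hbdd ⟨ε, hε, rfl⟩) (norm_nonneg _)

/-- A negative logarithmic norm quantifies dissipativity. -/
theorem one_sub_logNorm_mul_norm_le (A : X →ₗ.[ℝ] X) (hA : logNorm A < 0) (u : A.domain)
    {h : ℝ} (hh : 0 < h) : (1 - logNorm A * h) * ‖(u : X)‖ ≤ ‖(u : X) - h • A u‖ := by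
  by_cases hu : (u : X) = 0
  · simp [hu]
  have hpos : 0 < ‖(u : X)‖ := norm_pos_iff.2 hu
  have hbdd : BddAbove
      {r : ℝ | ∃ u : A.domain, (u : X) ≠ 0 ∧ r = semiInner (A u) (u : X) / ‖(u : X)‖ ^ 2} := by
    by_contra hb
    rw [logNorm, Real.sSup_of_not_bddAbove hb] at hA
    exact lt_irrefl _ hA
  have h1 : semiInner (A u) (u : X) / ‖(u : X)‖ ^ 2 ≤ logNorm A := le_csSup hbdd ⟨u, hu, rfl⟩
  rw [div_le_iff₀ (by positivity)] at h1
  -- The slope at `ε = -h` involves exactly `‖u - hAu‖`.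
  have h2 := (norm_mul_norm_slope_le_semiInner (A u) (u : X) (neg_lt_zero.2 hh)).trans h1
  rw [neg_smul, ← sub_eq_add_neg, sq, ← mul_assoc, mul_comm (logNorm A), mul_assoc] at h2
  have h3 := le_of_mul_le_mul_left h2 hpos
  rw [div_le_iff_of_neg (neg_lt_zero.2 hh)] at h3
  linarith

end DirectionalDerivative

/-! ### Exponential decay and continuity of the semigroup -/

section Semigroup

variable {X : Type*} [NormedAddCommGroup X] [NormedSpace ℝ X]

theorem IsC0Semigroup.map_add_apply {T : ℝ → X →L[ℝ] X} (hT : IsC0Semigroup T) {a b : ℝ}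
    (ha : 0 ≤ a) (hb : 0 ≤ b) (x : X) : T (a + b) x = T a (T b x) := by
  rw [hT.map_add a b ha hb]; rfl

/-- Otherwise `‖T (t n)‖ > n` along some `t n → 0⁺`, although each orbit `T (t n) x` converges and
is therefore bounded; this contradicts Banach–Steinhaus. -/
theorem IsC0Semigroup.exists_norm_le_near_zero [CompleteSpace X] {T : ℝ → X →L[ℝ] X}
    (hT : IsC0Semigroup T) :
    ∃ δ > 0, ∃ K, ∀ t ∈ Ioo (0 : ℝ) δ, ‖T t‖ ≤ K := by
  by_contra! hcon
  choose! t ht htn using fun n : ℕ => hcon (1 / ((n : ℝ) + 1)) (by positivity) (n : ℝ)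
  have htend : Tendsto t atTop (𝓝[>] 0) := by
    refine tendsto_nhdsWithin_iff.2 ⟨?_, Eventually.of_forall fun n => (ht n).1⟩
    exact squeeze_zero (fun n => (ht n).1.le) (fun n => (ht n).2.le)
      tendsto_one_div_add_atTop_nhds_zero_nat
  obtain ⟨K, hK⟩ := banach_steinhaus (g := fun n => T (t n)) fun x => by
    obtain ⟨C, hC⟩ := ((hT.tendsto_zero x).comp htend).norm.bddAbove_range
    exact ⟨C, fun n => hC ⟨n, rfl⟩⟩
  obtain ⟨n, hn⟩ := exists_nat_gt K
  exact absurd (hK n) (not_le.2 (hn.trans (htn n)))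

theorem IsC0Semigroup.exists_norm_le [CompleteSpace X] {T : ℝ → X →L[ℝ] X}
    (hT : IsC0Semigroup T) (a : ℝ) : ∃ K, ∀ t ∈ Icc (0 : ℝ) a, ‖T t‖ ≤ K := by
  obtain ⟨δ, hδ, K, hK⟩ := hT.exists_norm_le_near_zero
  have hK1 : ∀ t ∈ Ico (0 : ℝ) δ, ‖T t‖ ≤ max K 1 := by
    intro t ht
    rcases ht.1.eq_or_lt with rfl | h0
    · rw [hT.map_zero]
      exact ContinuousLinearMap.norm_id_le.trans (le_max_right _ _)
    · exact (hK t ⟨h0, ht.2⟩).trans (le_max_left _ _)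
  -- One `n` serves every `t ≤ a`: `t/n < δ`, and `T t` is the `n`-th power of `T (t/n)`.
  obtain ⟨n, hn⟩ := exists_nat_gt (a / δ)
  have hpow : ∀ (k : ℕ) (t : ℝ), 0 ≤ t → t < δ → ‖T (k * t)‖ ≤ (max K 1) ^ k := by
    intro k t h0 h1
    induction k with
    | zero => simpa [hT.map_zero] using ContinuousLinearMap.norm_id_le
    | succ k ih =>
      rw [Nat.cast_succ, add_mul, one_mul, hT.map_add _ _ (by positivity) h0, pow_succ]
      exact (ContinuousLinearMap.opNorm_comp_le _ _).trans
        (mul_le_mul ih (hK1 t ⟨h0, h1⟩) (norm_nonneg _) (by positivity))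
  refine ⟨(max K 1) ^ n, fun t ht => ?_⟩
  have hn0 : (0 : ℝ) < n := lt_of_le_of_lt (div_nonneg (ht.1.trans ht.2) hδ.le) hn
  have hlt : t / n < δ := by
    rw [div_lt_iff₀ hδ] at hn
    rw [div_lt_iff₀ hn0]
    linarith [ht.2]
  have := hpow n (t / n) (div_nonneg ht.1 hn0.le) hlt
  rwa [mul_div_cancel₀ _ hn0.ne'] at this

theorem IsGenerator.map_mem_graph {A : X →ₗ.[ℝ] X} {T : ℝ → X →L[ℝ] X} (hT : IsC0Semigroup T)
    (hA : IsGenerator A T) {x y : X} (hxy : (x, y) ∈ A.graph) {t : ℝ} (ht : 0 ≤ t) :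
    (T t x, T t y) ∈ A.graph := by
  rw [hA]
  refine (((T t).continuous.tendsto y).comp ((hA x y).1 hxy)).congr' ?_
  filter_upwards [self_mem_nhdsWithin] with h hh
  have hh : (0 : ℝ) ≤ h := le_of_lt hh
  simp only [Function.comp, map_smul, map_sub]
  rw [← hT.map_add_apply ht hh, add_comm, hT.map_add_apply hh ht]

/-- Dissipativity is applied to `v = T (t + h) x`: here `v - hAv` equals `T t x` plus `T t` of a
local error, which is `o(h)` because both terms of the last norm tend to `y`. -/
theorem norm_semigroup_step_le {A : X →ₗ.[ℝ] X} {T : ℝ → X →L[ℝ] X} (hT : IsC0Semigroup T)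
    (hA : IsGenerator A T) (hμ : logNorm A < 0) {x y : X} (hxy : (x, y) ∈ A.graph) {t h : ℝ}
    (ht : 0 ≤ t) (hh : 0 < h) :
    (1 - logNorm A * h) * ‖T (t + h) x‖
      ≤ ‖T t x‖ + ‖T t‖ * (h * ‖h⁻¹ • (T h x - x) - T h y‖) := by
  obtain ⟨v, hv, hv'⟩ := (LinearPMap.mem_graph_iff A).1
    (hA.map_mem_graph hT hxy (add_nonneg ht hh.le))
  have h1 := one_sub_logNorm_mul_norm_le A hμ v hh
  simp only at hv hv'
  rw [hv, hv'] at h1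
  have h2 : T (t + h) x - h • T (t + h) y
      = T t x + T t (h • (h⁻¹ • (T h x - x) - T h y)) := by
    rw [smul_sub, smul_smul, mul_inv_cancel₀ hh.ne', one_smul, hT.map_add_apply ht hh.le,
      hT.map_add_apply ht hh.le]
    simp only [map_sub, map_smul]
    abel
  rw [h2] at h1
  refine h1.trans ((norm_add_le _ _).trans ?_)
  gcongr
  refine ((T t).le_opNorm _).trans_eq ?_
  rw [norm_smul_of_nonneg hh.le]

theorem norm_semigroup_apply_le_of_mem_graph [CompleteSpace X] {A : X →ₗ.[ℝ] X}
    {T : ℝ → X →L[ℝ] X} (hT : IsC0Semigroup T) (hA : IsGenerator A T) (hμ : logNorm A < 0)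
    {x y : X} (hxy : (x, y) ∈ A.graph) {a : ℝ} (ha : 0 < a) :
    ‖T a x‖ ≤ Real.exp (logNorm A * a) * ‖x‖ := by
  set ω := logNorm A with hω
  obtain ⟨K, hK⟩ := hT.exists_norm_le a
  let e : ℝ → ℝ := fun h => ‖h⁻¹ • (T h x - x) - T h y‖
  have he : Tendsto e (𝓝[>] 0) (𝓝 0) := by
    simpa using (((hA x y).1 hxy).sub (hT.tendsto_zero y)).norm
  have hK0 : 0 ≤ K := (norm_nonneg _).trans (hK 0 ⟨le_rfl, ha.le⟩)
  -- Since `1 - ωh ≥ 1`, dividing by it at each step does not amplify earlier errors, so they merely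
  -- add up.
  have hiter : ∀ (h : ℝ), 0 < h → ∀ k : ℕ, k * h ≤ a →
      ‖T (k * h) x‖ ≤ ((1 - ω * h) ^ k)⁻¹ * ‖x‖ + k * (K * (h * e h)) := by
    intro h hh k
    have hc : 1 ≤ 1 - ω * h := by nlinarith
    have hc0 : 0 < 1 - ω * h := by linarith
    have hE : 0 ≤ K * (h * e h) := by positivity
    induction k with
    | zero => intro _; simp [hT.map_zero]
    | succ k ih =>
      intro hk
      push_cast at hk ⊢
      have hkh : (0 : ℝ) ≤ k * h := by positivity
      have hka : (k : ℝ) * h ≤ a := by linarith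
      have h1 := norm_semigroup_step_le hT hA hμ hxy hkh hh
      have h2 : ‖T (k * h)‖ * (h * e h) ≤ K * (h * e h) :=
        mul_le_mul_of_nonneg_right (hK _ ⟨hkh, hka⟩) (by positivity)
      have h3 := ih hka
      have h4 : (1 - ω * h) * ‖T (k * h + h) x‖
          ≤ ((1 - ω * h) ^ k)⁻¹ * ‖x‖ + (k + 1) * (K * (h * e h)) := by
        change (1 - ω * h) * _ ≤ _ + ‖T (k * h)‖ * (h * e h) at h1
        linarith
      rw [add_mul, one_mul, pow_succ, mul_inv]
      have h5 : (0 : ℝ) ≤ (k + 1) * (K * (h * e h)) := by positivity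
      have h6 : (1 - ω * h)⁻¹ ≤ 1 := inv_le_one_of_one_le₀ hc
      calc ‖T (k * h + h) x‖ = (1 - ω * h)⁻¹ * ((1 - ω * h) * ‖T (k * h + h) x‖) := by
            rw [inv_mul_cancel_left₀ hc0.ne']
        _ ≤ (1 - ω * h)⁻¹ * (((1 - ω * h) ^ k)⁻¹ * ‖x‖ + (k + 1) * (K * (h * e h))) := by
            gcongr
        _ = ((1 - ω * h) ^ k)⁻¹ * (1 - ω * h)⁻¹ * ‖x‖
              + (1 - ω * h)⁻¹ * ((k + 1) * (K * (h * e h))) := by ring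
        _ ≤ _ := by
            have := mul_le_of_le_one_left h5 h6
            linarith
  have hstep : Tendsto (fun n : ℕ => a / n) atTop (𝓝[>] 0) := by
    refine tendsto_nhdsWithin_iff.2 ⟨tendsto_const_div_atTop_nhds_zero_nat a, ?_⟩
    filter_upwards [eventually_gt_atTop 0] with n hn
    have : (0 : ℝ) < n := by exact_mod_cast hn
    exact div_pos ha this
  -- With `h = a/n` and `k = n` the accumulated error is `K * a * e (a / n)`.
  have hlim : Tendsto (fun n : ℕ => ((1 + (-ω * a) / n) ^ n)⁻¹ * ‖x‖ + K * (a * e (a / n))) atTop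
      (𝓝 ((Real.exp (-ω * a))⁻¹ * ‖x‖ + K * (a * 0))) :=
    (((Real.tendsto_one_add_div_pow_exp (-ω * a)).inv₀ (Real.exp_pos _).ne').mul_const _).add
      (((he.comp hstep).const_mul a).const_mul K)
  rw [← Real.exp_neg, neg_mul, neg_neg, mul_zero, mul_zero, add_zero] at hlim
  refine ge_of_tendsto hlim ?_
  filter_upwards [eventually_gt_atTop 0] with n hn
  have hn0 : (0 : ℝ) < n := by exact_mod_cast hn
  have h1 := hiter (a / n) (div_pos ha hn0) n (mul_div_cancel₀ _ hn0.ne').le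
  rw [mul_div_cancel₀ _ hn0.ne'] at h1
  refine h1.trans_eq ?_
  congr 1
  · congr 3; ring
  · field_simp

/-- The semigroup generated by a densely defined operator of negative logarithmic norm decays
exponentially at the rate of the logarithmic norm. -/
theorem norm_semigroup_apply_le [CompleteSpace X] {A : X →ₗ.[ℝ] X} {T : ℝ → X →L[ℝ] X}
    (hT : IsC0Semigroup T) (hA : IsGenerator A T) (hd : Dense (A.domain : Set X))
    (hμ : logNorm A < 0) {t : ℝ} (ht : 0 ≤ t) (x : X) :
    ‖T t x‖ ≤ Real.exp (logNorm A * t) * ‖x‖ := by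
  rcases ht.eq_or_lt with rfl | ht
  · simp [hT.map_zero]
  · refine hd.induction (P := fun x => ‖T t x‖ ≤ Real.exp (logNorm A * t) * ‖x‖)
      (fun x hx => ?_) (isClosed_le (by fun_prop) (by fun_prop)) x
    exact norm_semigroup_apply_le_of_mem_graph hT hA hμ (A.mem_graph ⟨x, hx⟩) ht

/-- For `a ≤ b`, `T b x - T a x = T a (T (b - a) x - x)`, so contractivity reduces continuity
everywhere to continuity at `0`. The absolute value treats both sides of `t₀` at once. -/
theorem IsC0Semigroup.continuousOn_of_contractive {T : ℝ → X →L[ℝ] X} (hT : IsC0Semigroup T)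
    (hc : ∀ t, 0 ≤ t → ∀ x, ‖T t x‖ ≤ ‖x‖) (x : X) :
    ContinuousOn (fun t => T t x) (Ici 0) := by
  have hle : ∀ a b : ℝ, 0 ≤ a → a ≤ b → ‖T b x - T a x‖ ≤ ‖T |b - a| x - x‖ := by
    intro a b ha hab
    have hba : 0 ≤ b - a := sub_nonneg.2 hab
    have : T b x - T a x = T a (T |b - a| x - x) := by
      rw [abs_of_nonneg hba, map_sub, ← hT.map_add_apply ha hba, add_sub_cancel]
    rw [this]
    exact hc a ha _
  have h0 : Tendsto (fun t => T t x) (𝓝[≥] 0) (𝓝 x) := by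
    have h := continuousWithinAt_Ioi_iff_Ici.1
      (show ContinuousWithinAt (fun t => T t x) (Ioi 0) 0 by
        simpa [ContinuousWithinAt, hT.map_zero] using hT.tendsto_zero x)
    simpa [ContinuousWithinAt, hT.map_zero] using h
  intro t₀ ht₀
  have habs : Tendsto (fun t : ℝ => |t - t₀|) (𝓝[Ici 0] t₀) (𝓝[≥] 0) := by
    refine tendsto_nhdsWithin_iff.2 ⟨?_, Eventually.of_forall fun t => mem_Ici.2 (abs_nonneg _)⟩
    have : Continuous fun t : ℝ => |t - t₀| := by fun_prop
    simpa using (this.tendsto t₀).mono_left nhdsWithin_le_nhds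
  have hbound : Tendsto (fun t : ℝ => ‖T |t - t₀| x - x‖) (𝓝[Ici 0] t₀) (𝓝 0) := by
    simpa using ((h0.comp habs).sub_const x).norm
  rw [ContinuousWithinAt, tendsto_iff_norm_sub_tendsto_zero]
  refine squeeze_zero' (Eventually.of_forall fun t => norm_nonneg _) ?_ hbound
  filter_upwards [self_mem_nhdsWithin] with t ht
  rcases le_total t₀ t with h | h
  · exact hle t₀ t ht₀ h
  · rw [norm_sub_rev, abs_sub_comm]
    exact hle t t₀ ht h

end Semigroup

/-- `Γ` is convex with `Γ(1) = Γ(2) = 1`, so its secant slope on `[s, 1]` is at most `0`. -/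
theorem one_le_Gamma_of_le_one {s : ℝ} (h0 : 0 < s) (h1 : s ≤ 1) : 1 ≤ Real.Gamma s := by
  rcases h1.eq_or_lt with rfl | h1
  · simp
  have h := Real.convexOn_Gamma.slope_mono_adjacent (x := s) (y := 1) (z := 2) h0
    (by norm_num) h1 (by norm_num)
  rw [Real.Gamma_one, Real.Gamma_two, sub_self, zero_div, div_le_iff₀ (by linarith)] at h
  linarith

/-! ### Convergence of the integral and its tail -/

section Truncation

variable {X : Type*} [NormedAddCommGroup X] [NormedSpace ℝ X]

theorem norm_solIntegrand_le {T : ℝ → X →L[ℝ] X} {ω s t z : ℝ} {w : X} (hz : 0 < z)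
    (hT : ‖T z w‖ ≤ Real.exp (ω * z) * ‖w‖) :
    ‖solIntegrand T s w t z‖ ≤ z ^ (s - 1) * Real.exp (ω * z) * ‖w‖ := by
  have hexp : Real.exp (-t ^ 2 / (4 * z)) ≤ 1 :=
    Real.exp_le_one_iff.2 (div_nonpos_of_nonpos_of_nonneg (by nlinarith [sq_nonneg t])
      (by positivity))
  have hzs : 0 ≤ z ^ (s - 1) := Real.rpow_nonneg hz.le _
  rw [solIntegrand, norm_smul_of_nonneg (by positivity), mul_assoc _ _ ‖w‖]
  exact mul_le_mul (mul_le_of_le_one_right hzs hexp) hT (norm_nonneg _) hzs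

/-- The dominating function is a Gamma integrand: `s > 0` handles `z = 0`, and `ω < 0` handles
infinity. -/
theorem integrableOn_solIntegrand {T : ℝ → X →L[ℝ] X} {ω s : ℝ} (hω : ω < 0) (hs : 0 < s)
    (w : X) (hcont : ContinuousOn (fun z => T z w) (Ici 0))
    (hT : ∀ z, 0 ≤ z → ‖T z w‖ ≤ Real.exp (ω * z) * ‖w‖) (t : ℝ) :
    IntegrableOn (solIntegrand T s w t) (Ioi 0) := by
  have hdom : IntegrableOn (fun z : ℝ => z ^ (s - 1) * Real.exp (ω * z) * ‖w‖) (Ioi 0) := by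
    have h := integrableOn_rpow_mul_exp_neg_mul_rpow (p := 1) (s := s - 1) (b := -ω)
      (by linarith) one_pos (by linarith)
    simp only [neg_neg, Real.rpow_one] at h
    exact h.mul_const _
  refine Integrable.mono' hdom ?_ ?_
  · refine ContinuousOn.aestronglyMeasurable ?_ measurableSet_Ioi
    refine ContinuousOn.smul (ContinuousOn.mul ?_ ?_) (hcont.mono Ioi_subset_Ici_self)
    · exact continuousOn_id.rpow_const fun z hz => Or.inl (ne_of_gt hz)
    · refine Real.continuous_exp.comp_continuousOn ?_
      exact continuousOn_const.div (by fun_prop) fun z hz =>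
        mul_ne_zero four_ne_zero (ne_of_gt hz)
  · filter_upwards [ae_restrict_mem measurableSet_Ioi] with z hz
    exact norm_solIntegrand_le hz (hT z (le_of_lt hz))

theorem norm_integral_tail_solIntegrand_le {T : ℝ → X →L[ℝ] X} {ω s M : ℝ} (hω : ω < 0)
    (hs : s ≤ 1) (hM : 0 < M) (w : X)
    (hT : ∀ z, 0 ≤ z → ‖T z w‖ ≤ Real.exp (ω * z) * ‖w‖) (t : ℝ) :
    ‖∫ z in Ioi M, solIntegrand T s w t z‖
      ≤ 1 / (-ω) * M ^ (s - 1) * Real.exp (ω * M) * ‖w‖ := by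
  have hint : IntegrableOn (fun z : ℝ => M ^ (s - 1) * ‖w‖ * Real.exp (ω * z)) (Ioi M) :=
    (integrableOn_exp_mul_Ioi hω M).const_mul _
  refine (norm_integral_le_of_norm_le hint ?_).trans_eq ?_
  · filter_upwards [ae_restrict_mem measurableSet_Ioi] with z hz
    have hMz : M < z := hz
    refine (norm_solIntegrand_le (hM.trans hMz) (hT z (hM.trans hMz).le)).trans ?_
    have := Real.rpow_le_rpow_of_nonpos hM hMz.le (sub_nonpos.2 hs)
    calc z ^ (s - 1) * Real.exp (ω * z) * ‖w‖
        ≤ M ^ (s - 1) * Real.exp (ω * z) * ‖w‖ := by gcongr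
      _ = _ := by ring
  · rw [integral_const_mul, integral_exp_mul_Ioi hω]
    have := hω.ne
    field_simp

theorem sol_sub_truncSol {T : ℝ → X →L[ℝ] X} {s M t : ℝ} {w : X} (hM : 0 ≤ M)
    (hint : IntegrableOn (solIntegrand T s w t) (Ioi 0)) :
    sol T s w t - truncSol T s M w t
      = (1 / Real.Gamma s) • ∫ z in Ioi M, solIntegrand T s w t z := by
  rw [sol, truncSol, ← smul_sub, intervalIntegral.integral_of_le hM, ← Ioc_union_Ioi_eq_Ioi hM,
    setIntegral_union (Ioc_disjoint_Ioi le_rfl) measurableSet_Ioi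
      (hint.mono_set Ioc_subset_Ioi_self) (hint.mono_set (Ioi_subset_Ioi hM)),
    add_sub_cancel_left]

end Truncation

end BesselExtension

theorem lemma3p1 (ω : ℝ) (hω : ω < 0) :
    ∃ C : ℝ, 0 < C ∧
      ∀ (X : Type*) [NormedAddCommGroup X] [NormedSpace ℝ X] [CompleteSpace X]
        [TopologicalSpace.SeparableSpace X]
        (A : X →ₗ.[ℝ] X) (T : ℝ → X →L[ℝ] X),
        A.IsClosed → Dense (A.domain : Set X) →
        BesselExtension.StrictlyMDissipative A →
        BesselExtension.logNorm A = ω →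
        BesselExtension.IsC0Semigroup T → BesselExtension.IsGenerator A T →
        ∀ s : ℝ, 0 < s → s < 1 →
        ∀ u₀ : (BesselExtension.fracPow (-A) s).domain,
        ∀ M : ℝ, 0 < M → ∀ t : ℝ, 0 ≤ t →
          IntegrableOn
            (BesselExtension.solIntegrand T s (BesselExtension.fracPow (-A) s u₀) t)
            (Ioi (0 : ℝ)) ∧
          ‖BesselExtension.sol T s (BesselExtension.fracPow (-A) s u₀) t
              - BesselExtension.truncSol T s M (BesselExtension.fracPow (-A) s u₀) t‖
            ≤ C * M ^ (s - 1) * Real.exp (ω * M) * ‖BesselExtension.fracPow (-A) s u₀‖ := by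
  refine ⟨1 / (-ω), one_div_pos.2 (neg_pos.2 hω), ?_⟩
  intro X _ _ _ _ A T _ hdense _ hμ hT hA s hs0 hs1 u₀ M hM t _
  -- The estimate holds for every vector `w` in place of `(-A)^s u₀`.
  generalize BesselExtension.fracPow (-A) s u₀ = w
  have hdecay : ∀ z, 0 ≤ z → ∀ x, ‖T z x‖ ≤ Real.exp (ω * z) * ‖x‖ := fun z hz x => by
    have h := BesselExtension.norm_semigroup_apply_le hT hA hdense (hμ ▸ hω) hz x
    rwa [hμ] at h
  have hcontr : ∀ z, 0 ≤ z → ∀ x, ‖T z x‖ ≤ ‖x‖ := fun z hz x =>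
    (hdecay z hz x).trans (mul_le_of_le_one_left (norm_nonneg _)
      (Real.exp_le_one_iff.2 (mul_nonpos_of_nonpos_of_nonneg hω.le hz)))
  have hint := BesselExtension.integrableOn_solIntegrand hω hs0 w
    (hT.continuousOn_of_contractive hcontr w) (fun z hz => hdecay z hz w) t
  refine ⟨hint, ?_⟩
  have hΓ := BesselExtension.one_le_Gamma_of_le_one hs0 hs1.le
  have hΓ' : 1 / Real.Gamma s ≤ 1 := by
    rw [one_div]; exact inv_le_one_of_one_le₀ hΓ
  rw [BesselExtension.sol_sub_truncSol hM.le hint,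
    norm_smul_of_nonneg (one_div_nonneg.2 (zero_le_one.trans hΓ))]
  exact (mul_le_of_le_one_left (norm_nonneg _) hΓ').trans
    (BesselExtension.norm_integral_tail_solIntegrand_le hω hs1.le hM w
      (fun z hz => hdecay z hz w) t)
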